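/- Let $X$ be an order complete (real) vector lattice. Let $X^u$ be its universal completion, i.e. an order complete and laterally complete vector lattice containing $X$ as an order dense vector sublattice. Let $X_s$ be its sup-completion (in the sense of Donner), i.e. an ordered cone $X_s\supseteq X$ that is a lattice, in which every non-empty set bounded above has a supremum, and such that: $X$ is the set of invertible elements of $X_s$, with the same algebraic and order structures; $y=\sup\{a\in X: a\le y\}$ for every $y\in X_s$; $x+f\wedge y=(x+f)\wedge(x+y)$ for $x,y\in X_s$, $f\in X$; if $y\in X_s$, $a\in X$ and $y\le a$ then $y\in X$; $X_s$ has a greatest element; and $(\sup A)\wedge x=\sup_{a\in A}(a\wedge x)$ for every $x\in X$ and every non-empty $A\subseteq X_s$ that has a supremum. Then the positive cone $X^u_+$ of $X^u$ is contained in $X_s$. More precisely, there is a map $\Phi:X^u_+\to X_s$ which is the identity on $X_+$, satisfies $\Phi(x)\le\Phi(y)\iff x\le y$, preserves finite suprema and infima, sums and multiplication by non-negative reals, and is such that for every $x\in X^u_+$ and every increasing net $(x_\alpha)$ in $X$ with supremum $x$ in $X^u$, the supremum of $(x_\alpha)$ in $X_s$ exists and equals $\Phi(x)$. Moreover, every $x\in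 X^u_+$ is the supremum in $X^u$ of an increasing net in $X$. -/

import Mathlib

open scoped NNReal

/-- Order (Dedekind) completeness: every non-empty subset that is bounded above has a supremum.
(Equivalently, every non-empty subset that is bounded below has an infimum.) -/
def IsOrderComplete (P : Type*) [PartialOrder P] : Prop :=
  ∀ S : Set P, S.Nonempty → BddAbove S → ∃ s, IsLUB S s

/-- Lateral completeness: every non-empty set of pairwise disjoint positive elements has a
supremum. -/
def IsLaterallyComplete (U : Type*) [AddCommGroup U] [Lattice U] : Prop :=
  ∀ S : Set U, S.Nonempty → (∀ x ∈ S, 0 ≤ x) → (S.Pairwise fun x y => x ⊓ y = 0) →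
    ∃ s, IsLUB S s

/-- `ι : X → U` exhibits the vector lattice `U` as a universal completion of the vector
lattice `X`: `U` is universally complete (order complete and laterally complete), and `ι` is an
injective linear lattice homomorphism whose range is order dense in `U`. -/
structure IsUniversalCompletion {X U : Type*}
    [AddCommGroup X] [Lattice X] [Module ℝ X]
    [AddCommGroup U] [Lattice U] [Module ℝ U] (ι : X →ₗ[ℝ] U) : Prop where
  orderComplete : IsOrderComplete U
  laterallyComplete : IsLaterallyComplete U
  injective : Function.Injective ι
  map_sup : ∀ a b : X, ι (a ⊔ b) = ι a ⊔ ι b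
  orderDense : ∀ u : U, 0 < u → ∃ a : X, 0 < a ∧ ι a ≤ u

/-- `j : X → C` exhibits the ordered cone `C` as a sup-completion (in the sense of Donner) of the
vector lattice `X`.  These properties determine `C` up to isomorphism when `X` is order complete,
and `SupCompletion.isSupCompletion` below shows that a sup-completion exists.  (The further
property `x = sup (k e ⊓ x)` for `0 ≤ x` and a weak order unit `e` is a consequence, hence is not
required.) -/
structure IsSupCompletion {X C : Type*}
    [AddCommGroup X] [Lattice X] [Module ℝ X]
    [AddCommMonoid C] [Lattice C] [Module ℝ≥0 C] (j : X → C) : Prop where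
  orderComplete : IsOrderComplete C
  /-- `X` is the set of invertible elements of `C` ... -/
  range_eq : Set.range j = {y | IsAddUnit y}
  /-- ... with the same algebraic and order structures. -/
  map_add : ∀ a b : X, j (a + b) = j a + j b
  map_smul : ∀ (r : ℝ≥0) (a : X), j ((r : ℝ) • a) = r • j a
  map_le_iff : ∀ a b : X, j a ≤ j b ↔ a ≤ b
  /-- Every element is the supremum of the elements of `X` below it. -/
  isLUB_below : ∀ y : C, IsLUB (j '' {a | j a ≤ y}) y
  add_inf : ∀ (x y : C) (f : X), x + j f ⊓ y = (x + j f) ⊓ (x + y)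
  /-- Tightness: `C` has no new elements below an element of `X`. -/
  tight : ∀ (a : X) (y : C), y ≤ j a → y ∈ Set.range j
  exists_top : ∃ t : C, ∀ y, y ≤ t
  /-- Meets with elements of `X` depend only on the supremum and commute with it. -/
  isLUB_inf : ∀ (A : Set C) (m : C), A.Nonempty → IsLUB A m →
    ∀ x : X, IsLUB ((fun a => a ⊓ j x) '' A) (m ⊓ j x)

/-! A concrete sup-completion: the non-empty lower subsets of `X` that are closed under all
existing suprema, ordered by inclusion, with the pointwise sum. -/

/-- Non-empty lower sets closed under existing suprema of non-empty subsets. -/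
@[ext]
structure SupCompletion (X : Type*) [Lattice X] where
  carrier : Set X
  nonempty' : carrier.Nonempty
  lower' : ∀ a ∈ carrier, ∀ b, b ≤ a → b ∈ carrier
  closed' : ∀ S : Set X, S ⊆ carrier → S.Nonempty → ∀ s, IsLUB S s → s ∈ carrier

namespace SupCompletion

section order
variable {X : Type*} [Lattice X]

theorem sup_mem (A : SupCompletion X) {a b : X} (ha : a ∈ A.carrier) (hb : b ∈ A.carrier) :
    a ⊔ b ∈ A.carrier :=
  A.closed' {a, b} (by rintro x (rfl | rfl) <;> assumption) ⟨a, by simp⟩ _ isLUB_pair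

instance : PartialOrder (SupCompletion X) :=
  PartialOrder.lift carrier fun _ _ h => SupCompletion.ext h

theorem le_def {A B : SupCompletion X} : A ≤ B ↔ A.carrier ⊆ B.carrier := Iff.rfl

/-- The supremum of a non-empty family. -/
def sup (F : Set (SupCompletion X)) (hF : F.Nonempty) : SupCompletion X where
  carrier := {x | ∀ D : SupCompletion X, (∀ A ∈ F, A ≤ D) → x ∈ D.carrier}
  nonempty' := by
    obtain ⟨A, hA⟩ := hF
    obtain ⟨a, ha⟩ := A.nonempty'
    exact ⟨a, fun D hD => hD A hA ha⟩
  lower' := fun a ha b hb D hD => D.lower' a (ha D hD) b hb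
  closed' := fun S hS hn s hs D hD => D.closed' S (fun x hx => hS hx D hD) hn s hs

theorem isLUB_sup (F : Set (SupCompletion X)) (hF : F.Nonempty) : IsLUB F (sup F hF) :=
  ⟨fun _ hA _ ha _ hD => hD _ hA ha, fun D hD _ hx => hx D fun _ hA => hD hA⟩

instance : Lattice (SupCompletion X) where
  sup A B := sup {A, B} ⟨A, by simp⟩
  le_sup_left A B := (isLUB_sup {A, B} ⟨A, by simp⟩).1 (by simp)
  le_sup_right A B := (isLUB_sup {A, B} ⟨A, by simp⟩).1 (by simp)
  sup_le A B D h1 h2 := (isLUB_sup {A, B} ⟨A, by simp⟩).2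
    (by rintro x (rfl | rfl) <;> assumption)
  inf A B :=
    { carrier := A.carrier ∩ B.carrier
      nonempty' := by
        obtain ⟨a, ha⟩ := A.nonempty'
        obtain ⟨b, hb⟩ := B.nonempty'
        exact ⟨a ⊓ b, A.lower' a ha _ inf_le_left, B.lower' b hb _ inf_le_right⟩
      lower' := fun a ha b hb => ⟨A.lower' a ha.1 b hb, B.lower' a ha.2 b hb⟩
      closed' := fun S hS hn s hs => ⟨A.closed' S (fun x hx => (hS hx).1) hn s hs,
        B.closed' S (fun x hx => (hS hx).2) hn s hs⟩ }
  inf_le_left _ _ _ h := h.1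
  inf_le_right _ _ _ h := h.2
  le_inf _ _ _ h1 h2 _ h := ⟨h1 h, h2 h⟩

theorem mem_inf {A B : SupCompletion X} {x : X} :
    x ∈ (A ⊓ B).carrier ↔ x ∈ A.carrier ∧ x ∈ B.carrier := Iff.rfl

/-- The embedding of `X`. -/
def of (a : X) : SupCompletion X where
  carrier := Set.Iic a
  nonempty' := ⟨a, le_rfl⟩
  lower' := fun _ hb _ hc => le_trans hc hb
  closed' := fun _ hS _ _ hs => hs.2 hS

theorem mem_of {a x : X} : x ∈ (of a).carrier ↔ x ≤ a := Iff.rfl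

theorem of_le {a : X} {A : SupCompletion X} : of a ≤ A ↔ a ∈ A.carrier :=
  ⟨fun h => h (le_refl a), fun h x hx => A.lower' a h x hx⟩

end order

section algebra
variable {X : Type*} [AddCommGroup X] [Lattice X] [IsOrderedAddMonoid X]

theorem isLUB_inf_right {S : Set X} {s : X} (hs : IsLUB S s) (x : X) :
    IsLUB ((fun w => w ⊓ x) '' S) (s ⊓ x) := by
  refine ⟨?_, fun u hu => ?_⟩
  · rintro _ ⟨w, hw, rfl⟩
    exact inf_le_inf_right x (hs.1 hw)
  · have h : s ≤ u + (s ⊔ x) - x := hs.2 fun w hw => by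
      have h1 : w ⊓ x ≤ u := hu ⟨w, hw, rfl⟩
      have h2 : w ⊓ x + (w ⊔ x) ≤ u + (s ⊔ x) :=
        add_le_add h1 (sup_le_sup_right (hs.1 hw) x)
      rw [inf_add_sup] at h2
      exact le_sub_iff_add_le.2 h2
    have h3 : s + x ≤ u + (s ⊔ x) := le_sub_iff_add_le.1 h
    rw [← inf_add_sup] at h3
    exact le_of_add_le_add_right h3

/-- The sum of two closed lower sets is the pointwise sum. -/
def add (hX : IsOrderComplete X) (A B : SupCompletion X) : SupCompletion X where
  carrier := {x | ∃ a ∈ A.carrier, ∃ b ∈ B.carrier, a + b = x}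
  nonempty' := by
    obtain ⟨a, ha⟩ := A.nonempty'
    obtain ⟨b, hb⟩ := B.nonempty'
    exact ⟨a + b, a, ha, b, hb, rfl⟩
  lower' := by
    rintro _ ⟨a, ha, b, hb, rfl⟩ x hx
    exact ⟨x - b, A.lower' a ha _ (sub_le_iff_le_add.2 hx), b, hb, sub_add_cancel x b⟩
  closed' := by
    intro S hS hn s hs
    obtain ⟨b₀, hb₀⟩ := B.nonempty'
    obtain ⟨a₀, ha₀⟩ := A.nonempty'
    set T : Set X := {a | a ∈ A.carrier ∧ a ≤ s - b₀} with hT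
    have hTn : T.Nonempty := ⟨a₀ ⊓ (s - b₀), A.lower' _ ha₀ _ inf_le_left, inf_le_right⟩
    obtain ⟨t, ht⟩ := hX T hTn ⟨s - b₀, fun a ha => ha.2⟩
    refine ⟨t, A.closed' T (fun a ha => ha.1) hTn t ht, s - t, ?_, by abel⟩
    refine B.closed' ((fun x => x - t) '' S) ?_ (hn.image _) _ ⟨?_, ?_⟩
    · rintro _ ⟨x, hx, rfl⟩
      obtain ⟨a, ha, b, hb, rfl⟩ := hS hx
      refine B.lower' _ (B.sup_mem hb hb₀) _ ?_
      have h1 : a ⊓ (s - b₀) ≤ t := ht.1 ⟨A.lower' _ ha _ inf_le_left, inf_le_right⟩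
      have h2 : a + b ≤ s := hs.1 hx
      show a + b - t ≤ b ⊔ b₀
      have h3 : a + b - (b ⊔ b₀) ≤ a ⊓ (s - b₀) := by
        refine le_inf ?_ ?_
        · exact sub_le_iff_le_add.2 (add_le_add_right le_sup_left a)
        · exact sub_le_sub h2 le_sup_right
      have h4 := sub_le_iff_le_add.1 (h3.trans h1)
      rw [add_comm t] at h4
      exact sub_le_iff_le_add.2 h4
    · rintro _ ⟨x, hx, rfl⟩
      exact sub_le_sub_right (hs.1 hx) t
    · intro u hu
      refine sub_le_iff_le_add.2 (hs.2 fun x hx => sub_le_iff_le_add.1 (hu ⟨x, hx, rfl⟩))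

theorem mem_add {hX : IsOrderComplete X} {A B : SupCompletion X} {x : X} :
    x ∈ (add hX A B).carrier ↔ ∃ a ∈ A.carrier, ∃ b ∈ B.carrier, a + b = x := Iff.rfl

/-- The additive structure of the sup-completion. -/
@[reducible] def addCommMonoid (hX : IsOrderComplete X) : AddCommMonoid (SupCompletion X) where
  add := add hX
  zero := of 0
  nsmul := @nsmulRec _ ⟨of 0⟩ ⟨add hX⟩
  add_assoc A B D := by
    ext x
    constructor
    · rintro ⟨_, ⟨a, ha, b, hb, rfl⟩, d, hd, rfl⟩
      exact ⟨a, ha, b + d, ⟨b, hb, d, hd, rfl⟩, by abel⟩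
    · rintro ⟨a, ha, _, ⟨b, hb, d, hd, rfl⟩, rfl⟩
      exact ⟨a + b, ⟨a, ha, b, hb, rfl⟩, d, hd, by abel⟩
  zero_add A := by
    ext x
    constructor
    · rintro ⟨z, hz, a, ha, rfl⟩
      exact A.lower' a ha _ (add_le_of_nonpos_left hz)
    · exact fun hx => ⟨0, le_rfl, x, hx, zero_add x⟩
  add_zero A := by
    ext x
    constructor
    · rintro ⟨a, ha, z, hz, rfl⟩
      exact A.lower' a ha _ (add_le_of_nonpos_right hz)
    · exact fun hx => ⟨x, hx, 0, le_rfl, add_zero x⟩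
  add_comm A B := by
    ext x
    constructor
    · rintro ⟨a, ha, b, hb, rfl⟩
      exact ⟨b, hb, a, ha, add_comm b a⟩
    · rintro ⟨a, ha, b, hb, rfl⟩
      exact ⟨b, hb, a, ha, add_comm b a⟩

theorem isOrderedAddMonoid (hX : IsOrderComplete X) :
    @IsOrderedAddMonoid (SupCompletion X) (addCommMonoid hX) inferInstance :=
  letI := addCommMonoid hX
  { add_le_add_left := by
      rintro A B h D _ ⟨a, ha, d, hd, rfl⟩
      exact ⟨a, h ha, d, hd, rfl⟩ }

variable [Module ℝ X] [PosSMulMono ℝ X]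

/-- Multiplication by a non-negative scalar. -/
def smul (r : ℝ≥0) (A : SupCompletion X) : SupCompletion X where
  carrier := {x | ∃ a ∈ A.carrier, x ≤ (r : ℝ) • a}
  nonempty' := by
    obtain ⟨a, ha⟩ := A.nonempty'
    exact ⟨(r : ℝ) • a, a, ha, le_rfl⟩
  lower' := by
    rintro x ⟨a, ha, hx⟩ y hy
    exact ⟨a, ha, hy.trans hx⟩
  closed' := by
    intro S hS hn s hs
    rcases eq_or_ne r 0 with rfl | hr
    · obtain ⟨a, ha⟩ := A.nonempty'
      refine ⟨a, ha, hs.2 fun x hx => ?_⟩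
      obtain ⟨b, hb, h⟩ := hS hx
      simpa using h
    · have hr' : (0 : ℝ) < r := NNReal.coe_pos.2 (pos_iff_ne_zero.2 hr)
      have hinv : (0 : ℝ) ≤ (r : ℝ)⁻¹ := (inv_pos.2 hr').le
      refine ⟨(r : ℝ)⁻¹ • s, A.closed' ((fun x => (r : ℝ)⁻¹ • x) '' S) ?_ (hn.image _) _
        ⟨?_, ?_⟩, by rw [smul_inv_smul₀ hr'.ne']⟩
      · rintro _ ⟨x, hx, rfl⟩
        obtain ⟨a, ha, h⟩ := hS hx
        refine A.lower' a ha _ ?_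
        have := smul_le_smul_of_nonneg_left h hinv
        rwa [inv_smul_smul₀ hr'.ne'] at this
      · rintro _ ⟨x, hx, rfl⟩
        exact smul_le_smul_of_nonneg_left (hs.1 hx) hinv
      · intro u hu
        have h : s ≤ (r : ℝ) • u := hs.2 fun x hx => by
          have := smul_le_smul_of_nonneg_left (hu ⟨x, hx, rfl⟩) hr'.le
          simpa only [smul_inv_smul₀ hr'.ne'] using this
        have := smul_le_smul_of_nonneg_left h hinv
        rwa [inv_smul_smul₀ hr'.ne'] at this

/-- The cone structure of the sup-completion. -/
@[reducible] def module (hX : IsOrderComplete X) :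
    letI := addCommMonoid hX
    Module ℝ≥0 (SupCompletion X) :=
  letI := addCommMonoid hX
  { smul := smul
    one_smul := fun A => by
      ext x
      constructor
      · rintro ⟨a, ha, hx⟩
        exact A.lower' a ha x (by simpa using hx)
      · exact fun hx => ⟨x, hx, by simp⟩
    mul_smul := fun r s A => by
      ext x
      constructor
      · rintro ⟨a, ha, hx⟩
        exact ⟨(s : ℝ) • a, ⟨a, ha, le_rfl⟩, by simpa [mul_smul] using hx⟩
      · rintro ⟨b, ⟨a, ha, hb⟩, hx⟩
        refine ⟨a, ha, hx.trans ?_⟩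
        rw [NNReal.coe_mul, mul_smul]
        exact smul_le_smul_of_nonneg_left hb r.2
    smul_zero := fun r => by
      ext x
      constructor
      · rintro ⟨a, ha, hx⟩
        refine hx.trans ?_
        have := smul_le_smul_of_nonneg_left (show a ≤ 0 from ha) r.2
        simpa using this
      · intro hx
        exact ⟨0, le_rfl, by simpa using (show x ≤ 0 from hx)⟩
    smul_add := fun r A B => by
      ext x
      constructor
      · rintro ⟨_, ⟨a, ha, b, hb, rfl⟩, hx⟩
        refine (add hX (smul r A) (smul r B)).lower' ((r : ℝ) • a + (r : ℝ) • b)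
          ⟨_, ⟨a, ha, le_rfl⟩, _, ⟨b, hb, le_rfl⟩, rfl⟩ x ?_
        rwa [smul_add] at hx
      · rintro ⟨_, ⟨a, ha, hp⟩, _, ⟨b, hb, hq⟩, rfl⟩
        refine ⟨a + b, ⟨a, ha, b, hb, rfl⟩, ?_⟩
        rw [smul_add]
        exact add_le_add hp hq
    add_smul := fun r s A => by
      ext x
      constructor
      · rintro ⟨a, ha, hx⟩
        refine (add hX (smul r A) (smul s A)).lower' ((r : ℝ) • a + (s : ℝ) • a)
          ⟨_, ⟨a, ha, le_rfl⟩, _, ⟨a, ha, le_rfl⟩, rfl⟩ x ?_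
        rwa [NNReal.coe_add, add_smul] at hx
      · rintro ⟨_, ⟨a, ha, hp⟩, _, ⟨b, hb, hq⟩, rfl⟩
        refine ⟨a ⊔ b, A.sup_mem ha hb, ?_⟩
        rw [NNReal.coe_add, add_smul]
        exact add_le_add (hp.trans (smul_le_smul_of_nonneg_left le_sup_left r.2))
          (hq.trans (smul_le_smul_of_nonneg_left le_sup_right s.2))
    zero_smul := fun A => by
      ext x
      constructor
      · rintro ⟨a, ha, hx⟩
        exact (show x ≤ 0 by simpa using hx)
      · intro hx
        obtain ⟨a, ha⟩ := A.nonempty'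
        exact ⟨a, ha, by simpa using (show x ≤ 0 from hx)⟩ }

theorem posSMulMono (hX : IsOrderComplete X) :
    letI := addCommMonoid hX
    letI := module hX
    PosSMulMono ℝ≥0 (SupCompletion X) :=
  letI := addCommMonoid hX
  letI := module hX
  ⟨by
    rintro r _ A B h x ⟨a, ha, hx⟩
    exact ⟨a, h ha, hx⟩⟩

/-- Every order complete vector lattice has a sup-completion. -/
theorem isSupCompletion (hX : IsOrderComplete X) :
    letI := addCommMonoid hX
    letI := module hX
    IsSupCompletion (of : X → SupCompletion X) := by
  let _ := addCommMonoid hX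
  let _ := module hX
  have key : ∀ (A : SupCompletion X) (a : X), a ∈ A.carrier → (∀ b ∈ A.carrier, b ≤ a) →
      of a = A := fun A a ha h =>
    le_antisymm (of_le.2 ha) h
  have hadd : ∀ a b : X, (of (a + b) : SupCompletion X) = of a + of b := fun a b => by
    refine key _ _ ⟨a, le_rfl, b, le_rfl, rfl⟩ ?_
    rintro _ ⟨p, hp, q, hq, rfl⟩
    exact add_le_add hp hq
  refine
    { orderComplete := fun S hn _ => ⟨sup S hn, isLUB_sup S hn⟩
      range_eq := ?_
      map_add := hadd
      map_smul := ?_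
      map_le_iff := fun a b => of_le
      isLUB_below := ?_
      add_inf := ?_
      tight := ?_
      exists_top := ⟨⟨Set.univ, ⟨0, trivial⟩, fun _ _ _ _ => trivial,
        fun _ _ _ _ _ => trivial⟩, fun _ _ _ => trivial⟩
      isLUB_inf := ?_ }
  · ext A
    constructor
    · rintro ⟨a, rfl⟩
      refine IsAddUnit.of_add_eq_zero (of (-a)) ?_
      rw [← hadd, add_neg_cancel]
      rfl
    · intro hA
      obtain ⟨B, hB⟩ := hA.exists_neg
      have h0 : (0 : X) ∈ (A + B).carrier := by
        rw [hB]
        exact le_refl (0 : X)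
      obtain ⟨a, ha, b, hb, hab⟩ := h0
      refine ⟨a, key A a ha fun a' ha' => ?_⟩
      have h1 : a' + b ∈ (A + B).carrier := ⟨a', ha', b, hb, rfl⟩
      rw [hB] at h1
      have h2 : a' + b ≤ a + b := by
        rw [hab]
        exact h1
      exact le_of_add_le_add_right h2
  · intro r a
    refine key _ _ ⟨a, le_rfl, le_rfl⟩ ?_
    rintro x ⟨b, hb, hx⟩
    exact hx.trans (smul_le_smul_of_nonneg_left hb r.2)
  · intro A
    refine ⟨?_, fun D hD a ha => of_le.1 (hD ⟨a, of_le.2 ha, rfl⟩)⟩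
    rintro _ ⟨a, ha, rfl⟩
    exact ha
  · intro A B f
    ext x
    constructor
    · rintro ⟨a, ha, b, hb, rfl⟩
      exact ⟨⟨a, ha, b, hb.1, rfl⟩, ⟨a, ha, b, hb.2, rfl⟩⟩
    · rintro ⟨⟨a, ha, c, hc, h1⟩, ⟨a', ha', b, hb, h2⟩⟩
      have h3 : x - (a ⊔ a') ≤ c := by
        rw [← h1]
        exact sub_le_iff_le_add'.2 (add_le_add_left le_sup_left c)
      have h4 : x - (a ⊔ a') ≤ b := by
        rw [← h2]
        exact sub_le_iff_le_add'.2 (add_le_add_left le_sup_right b)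
      exact ⟨a ⊔ a', A.sup_mem ha ha', x - (a ⊔ a'),
        ⟨h3.trans hc, B.lower' b hb _ h4⟩, by abel⟩
  · intro a A hA
    obtain ⟨s, hs⟩ := hX A.carrier A.nonempty' ⟨a, fun x hx => hA hx⟩
    exact ⟨s, key A s (A.closed' _ le_rfl A.nonempty' s hs) fun b hb => hs.1 hb⟩
  · intro F M hF hM x
    refine ⟨?_, fun D hD => ?_⟩
    · rintro _ ⟨A, hA, rfl⟩
      exact inf_le_inf_right _ (hM.1 hA)
    · let D' : SupCompletion X :=
        { carrier := {w | w ⊓ x ∈ D.carrier}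
          nonempty' := by
            obtain ⟨d, hd⟩ := D.nonempty'
            exact ⟨d, D.lower' d hd _ inf_le_left⟩
          lower' := fun a ha b hb => D.lower' _ ha _ (inf_le_inf_right x hb)
          closed' := fun S hS hn s hs => D.closed' _ (by
            rintro _ ⟨w, hw, rfl⟩
            exact hS hw) (hn.image _) _ (isLUB_inf_right hs x) }
      have hD' : M ≤ D' := hM.2 fun A hA w hw =>
        hD ⟨A, hA, rfl⟩ ⟨A.lower' w hw _ inf_le_left, inf_le_right⟩
      rintro z ⟨hz, hzx⟩
      have h : z ⊓ x ∈ D.carrier := hD' hz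
      rwa [inf_eq_left.2 hzx] at h

end algebra

end SupCompletion

/-! Define `Φ x` as the supremum in `C` of the elements of `X` below `x`. Everything rests on the
equivalence `j a ≤ Φ x ↔ ι a ≤ x` (`map_le_iff_of_isLUB_below`): `x` and `Φ x` lie above the same
elements of `X`, and each is the supremum of these, so order and meets agree at once.

Suprema in `U` and in `C` are compared through `X`. If `a` lies below the supremum of `B` in either
completion, infinite distributivity gives `a = sup (b ⊓ a)` over `b ∈ B`. This is a statement inside
`X`, and both embeddings preserve it. Hence a subset of `X` with supremum `x` in `U` has supremum `Φ
x` in `C` (`isLUB_map_image_of_isLUB`), which settles nets, joins and `Φ (x + y) ≤ Φ x + Φ y`. The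
reverse inequality splits an element of `X` below a sum (`exists_add_of_map_le_add`). -/

namespace IsUniversalCompletion

/-! ### Suprema in the universal completion -/

variable {X U : Type*}
  [AddCommGroup X] [Lattice X] [Module ℝ X]
  [AddCommGroup U] [Lattice U] [Module ℝ U] {ι : X →ₗ[ℝ] U}

theorem map_le_iff (hι : IsUniversalCompletion ι) {a b : X} : ι a ≤ ι b ↔ a ≤ b := by
  rw [← sup_eq_right, ← hι.map_sup, hι.injective.eq_iff, sup_eq_right]

theorem map_inf [IsOrderedAddMonoid X] [IsOrderedAddMonoid U] (hι : IsUniversalCompletion ι)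
    (a b : X) : ι (a ⊓ b) = ι a ⊓ ι b := by
  have h := congrArg ι (inf_add_sup a b)
  rw [map_add, map_add, hι.map_sup, ← inf_add_sup (ι a) (ι b)] at h
  exact add_right_cancel h

/-- The embedding into the universal completion preserves all existing suprema. -/
theorem isLUB_image [IsOrderedAddMonoid X] [IsOrderedAddMonoid U]
    (hι : IsUniversalCompletion ι) {S : Set X} {s : X} (hs : IsLUB S s) :
    IsLUB (ι '' S) (ι s) := by
  refine ⟨?_, fun u hu => ?_⟩
  · rintro _ ⟨a, ha, rfl⟩
    exact hι.map_le_iff.2 (hs.1 ha)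
  · by_contra hsu
    have hlt : u ⊓ ι s < ι s := lt_of_le_of_ne inf_le_right fun h => hsu (inf_eq_right.1 h)
    -- Order density puts some `c > 0` into the gap, and then `s - c` still bounds `S`.
    obtain ⟨c, hc, hcs⟩ := hι.orderDense _ (sub_pos.2 hlt)
    have h : s ≤ s - c := hs.2 fun b hb => by
      rw [← hι.map_le_iff, map_sub]
      exact (le_inf (hu ⟨b, hb, rfl⟩) (hι.map_le_iff.2 (hs.1 hb))).trans (le_sub_comm.1 hcs)
    exact hc.not_ge ((le_sub_self_iff s).1 h)

theorem isLUB_of_isLUB_image (hι : IsUniversalCompletion ι) {S : Set X} {s : X}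
    (hs : IsLUB (ι '' S) (ι s)) : IsLUB S s :=
  hs.of_image hι.map_le_iff

/-- Every positive element of the universal completion is the supremum of the elements of `X`
below it. -/
theorem isLUB_below [IsOrderedAddMonoid U] (hι : IsUniversalCompletion ι) {x : U} (hx : 0 ≤ x) :
    IsLUB (ι '' {a | ι a ≤ x}) x := by
  have hne : (ι '' {a | ι a ≤ x}).Nonempty := ⟨_, 0, by simpa using hx, rfl⟩
  have hub : x ∈ upperBounds (ι '' {a | ι a ≤ x}) := by
    rintro _ ⟨a, ha, rfl⟩
    exact ha
  obtain ⟨v, hv⟩ := hι.orderComplete _ hne ⟨x, hub⟩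
  rcases (hv.2 hub).eq_or_lt with rfl | hlt
  · exact hv
  · obtain ⟨c, hc, hcx⟩ := hι.orderDense _ (sub_pos.2 hlt)
    have h : v ≤ v - ι c := hv.2 <| by
      rintro _ ⟨a, ha, rfl⟩
      refine le_sub_iff_add_le.2 (hv.1 ⟨a + c, ?_, map_add ι a c⟩)
      refine (map_add ι a c).trans_le ?_
      exact (add_le_add (hv.1 ⟨a, ha, rfl⟩) hcx).trans_eq (add_sub_cancel v x)
    have hc' : ι c ≤ ι 0 := (map_zero ι).symm ▸ (le_sub_self_iff v).1 h
    exact (hc.not_ge (hι.map_le_iff.1 hc')).elim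

end IsUniversalCompletion

/-! ### Suprema and splitting in the sup-completion -/

namespace IsSupCompletion

variable {X C : Type*}
  [AddCommGroup X] [Lattice X] [Module ℝ X]
  [AddCommMonoid C] [Lattice C] [Module ℝ≥0 C] {j : X → C}

theorem map_zero (hj : IsSupCompletion j) : j 0 = 0 := by
  simpa using hj.map_smul 0 0

/-- By tightness `j a ⊓ j b` already comes from `X`, where it is a lower bound of `a` and `b`. -/
theorem map_inf (hj : IsSupCompletion j) (a b : X) : j (a ⊓ b) = j a ⊓ j b := by
  obtain ⟨t, ht⟩ := hj.tight a _ (inf_le_left : j a ⊓ j b ≤ j a)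
  refine le_antisymm (le_inf ((hj.map_le_iff _ _).2 inf_le_left)
    ((hj.map_le_iff _ _).2 inf_le_right)) ?_
  rw [← ht, hj.map_le_iff]
  exact le_inf ((hj.map_le_iff _ _).1 (ht.trans_le inf_le_left))
    ((hj.map_le_iff _ _).1 (ht.trans_le inf_le_right))

/-- The embedding into the sup-completion preserves all existing suprema. -/
theorem isLUB_image (hj : IsSupCompletion j) {S : Set X} {s : X} (hs : IsLUB S s) :
    IsLUB (j '' S) (j s) := by
  refine ⟨?_, fun y hy => ?_⟩
  · rintro _ ⟨a, ha, rfl⟩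
    exact (hj.map_le_iff _ _).2 (hs.1 ha)
  -- Cutting the bound `y` down by `j s` brings it into `X`, as an upper bound `t` of `S`.
  · obtain ⟨t, ht⟩ := hj.tight s (y ⊓ j s) inf_le_right
    refine le_trans ((hj.map_le_iff s t).2 (hs.2 fun b hb => ?_)) (ht.trans_le inf_le_left)
    rw [← hj.map_le_iff, ht]
    exact le_inf (hy ⟨b, hb, rfl⟩) ((hj.map_le_iff _ _).2 (hs.1 hb))

theorem le_of_forall_map_le (hj : IsSupCompletion j) {y z : C}
    (h : ∀ a, j a ≤ y → j a ≤ z) : y ≤ z :=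
  (hj.isLUB_below y).2 <| by
    rintro _ ⟨a, ha, rfl⟩
    exact h a ha

/-- The greatest element bounds every set. -/
theorem exists_isLUB (hj : IsSupCompletion j) {A : Set C} (hA : A.Nonempty) : ∃ m, IsLUB A m :=
  hj.orderComplete A hA (hj.exists_top.imp fun _ ht y _ => ht y)

/-- An element of `X` below a supremum in the sup-completion is a supremum in `X`. -/
theorem isLUB_inf_of_map_le (hj : IsSupCompletion j) {B : Set X} (hB : B.Nonempty) {m : C}
    (hm : IsLUB (j '' B) m) {a : X} (ha : j a ≤ m) : IsLUB ((fun b => b ⊓ a) '' B) a := by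
  have h := hj.isLUB_inf _ m (hB.image j) hm a
  rw [inf_eq_right.2 ha, Set.image_image] at h
  simp only [← hj.map_inf] at h
  refine IsLUB.of_image (f := j) (hj.map_le_iff _ _) ?_
  rwa [Set.image_image]

/-- Elements of `X` below a sum with a summand that is non-negative split accordingly. -/
theorem exists_add_of_map_le_add [IsOrderedAddMonoid C] (hj : IsSupCompletion j) {y z : C}
    (hy : 0 ≤ y) {c : X} (hc : j c ≤ y + z) : ∃ p q, p + q = c ∧ j p ≤ y ∧ j q ≤ z := by
  have h : j c ≤ y + j c ⊓ z := by
    rw [hj.add_inf]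
    exact le_inf (le_add_of_nonneg_left hy) hc
  -- The part `q` is `j c ⊓ z`, which tightness places in `X`; being invertible, it can be
  -- subtracted from `j c ≤ y + j q`.
  obtain ⟨q, hq⟩ := hj.tight c (j c ⊓ z) inf_le_left
  refine ⟨c - q, q, sub_add_cancel c q, ?_, hq.trans_le inf_le_right⟩
  rw [← hq] at h
  have h' := add_le_add_left h (j (-q))
  rwa [add_assoc, ← hj.map_add, ← hj.map_add, add_neg_cancel, hj.map_zero, add_zero,
    ← sub_eq_add_neg] at h'

end IsSupCompletion

/-! ### Transfer between the two completions and the embedding `Φ` -/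

section comparison

variable {X U C : Type*}
  [AddCommGroup X] [Lattice X] [IsOrderedAddMonoid X] [Module ℝ X]
  [AddCommGroup U] [Lattice U] [IsOrderedAddMonoid U] [Module ℝ U]
  [AddCommMonoid C] [Lattice C] [Module ℝ≥0 C]
  {ι : X →ₗ[ℝ] U} {j : X → C}

/-- The supremum in `C` of the elements of `X` below `x` lies above no further elements of `X`. -/
theorem map_le_iff_of_isLUB_below (hι : IsUniversalCompletion ι) (hj : IsSupCompletion j)
    {x : U} (hx : 0 ≤ x) {m : C} (hm : IsLUB (j '' {a | ι a ≤ x}) m) {a : X} :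
    j a ≤ m ↔ ι a ≤ x := by
  refine ⟨fun h => ?_, fun h => hm.1 ⟨a, h, rfl⟩⟩
  have h0 : ({a | ι a ≤ x} : Set X).Nonempty := ⟨0, by simpa using hx⟩
  -- In `X`, `a` is the supremum of the `b ⊓ a` with `ι b ≤ x`; `ι` preserves this, and `x` bounds
  -- the images.
  refine (hι.isLUB_image (hj.isLUB_inf_of_map_le h0 hm h)).2 ?_
  rintro _ ⟨_, ⟨b, hb, rfl⟩, rfl⟩
  exact (hι.map_le_iff.2 inf_le_left).trans hb

/-- A set with supremum `x` in `U` has the same supremum in `C` as the set of all elements of `X`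
below `x`. -/
theorem isLUB_map_image_of_isLUB (hι : IsUniversalCompletion ι) (hj : IsSupCompletion j)
    {x : U} {m : C} (hm : ∀ a, j a ≤ m ↔ ι a ≤ x) {B : Set X} (hB : IsLUB (ι '' B) x) :
    IsLUB (j '' B) m := by
  refine ⟨?_, fun y hy => hj.le_of_forall_map_le fun a ha => ?_⟩
  · rintro _ ⟨b, hb, rfl⟩
    exact (hm b).2 (hB.1 ⟨b, hb, rfl⟩)
  -- Distributivity in `U` makes `ι a` the supremum of the `ι (b ⊓ a)`. This descends to `X` and
  -- passes on to `C`, where `y` bounds the images.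
  · have h := SupCompletion.isLUB_inf_right hB (ι a)
    rw [inf_eq_right.2 ((hm a).1 ha), Set.image_image] at h
    simp only [← hι.map_inf] at h
    rw [← Set.image_image (fun u => ι u) (fun b => b ⊓ a)] at h
    refine (hj.isLUB_image (hι.isLUB_of_isLUB_image h)).2 ?_
    rintro _ ⟨_, ⟨b, hb, rfl⟩, rfl⟩
    exact ((hj.map_le_iff _ _).2 inf_le_left).trans (hy ⟨b, hb, rfl⟩)

end comparison

theorem proposition2p11 {X U C : Type*}
    -- `X` is an order complete vector lattice
    [AddCommGroup X] [Lattice X] [IsOrderedAddMonoid X] [Module ℝ X] [PosSMulMono ℝ X]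
    (hX : IsOrderComplete X)
    -- the vector lattice `U` is its universal completion
    [AddCommGroup U] [Lattice U] [IsOrderedAddMonoid U] [Module ℝ U] [PosSMulMono ℝ U]
    (ι : X →ₗ[ℝ] U) (hι : IsUniversalCompletion ι)
    -- the ordered cone `C` is its sup-completion
    [AddCommMonoid C] [Lattice C] [IsOrderedAddMonoid C] [Module ℝ≥0 C] [PosSMulMono ℝ≥0 C]
    (j : X → C) (hj : IsSupCompletion j) :
    -- there is an inclusion `Φ` of the positive cone of `U` into `C`
    ∃ Φ : {x : U // 0 ≤ x} → C,
      -- which is the identity on the positive cone of `X`,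
      (∀ (a : X) (ha : 0 ≤ ι a), Φ ⟨ι a, ha⟩ = j a) ∧
      -- and identifies order, lattice and cone structures,
      (∀ x y, Φ x ≤ Φ y ↔ x ≤ y) ∧
      (∀ x y, Φ (x ⊔ y) = Φ x ⊔ Φ y) ∧
      (∀ x y, Φ (x ⊓ y) = Φ x ⊓ Φ y) ∧
      (∀ x y, Φ (x + y) = Φ x + Φ y) ∧
      (∀ (r : ℝ≥0) (x : {x : U // 0 ≤ x}) (h : 0 ≤ (r : ℝ) • (x : U)),
        Φ ⟨(r : ℝ) • (x : U), h⟩ = r • Φ x) ∧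
      -- such that the supremum in `C` of every increasing net in `X` that converges up to `x`
      -- in `U` is `x`,
      (∀ (x : {x : U // 0 ≤ x}) {I : Type*} [Preorder I] [IsDirectedOrder I] [Nonempty I]
        (a : I → X), Monotone a → IsLUB (Set.range fun i => ι (a i)) (x : U) →
          IsLUB (Set.range fun i => j (a i)) (Φ x)) ∧
      -- where every positive `x` in `U` does have such a net (a directed set indexed by itself)
      (∀ x : {x : U // 0 ≤ x}, ∃ D : Set X, D.Nonempty ∧ DirectedOn (· ≤ ·) D ∧
        IsLUB (ι '' D) (x : U)) := by
  have hne : ∀ x : {x : U // 0 ≤ x}, (j '' {a | ι a ≤ x}).Nonempty := fun x =>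
    ⟨_, 0, by simpa using x.2, rfl⟩
  choose Φ hΦ using fun x => hj.exists_isLUB (hne x)
  have key : ∀ x a, j a ≤ Φ x ↔ ι a ≤ x := fun x _ =>
    map_le_iff_of_isLUB_below hι hj x.2 (hΦ x)
  have hle : ∀ x y, Φ x ≤ Φ y ↔ x ≤ y := fun x y => by
    refine ⟨fun h => ?_, fun h => hj.le_of_forall_map_le fun a ha =>
      (key y a).2 (((key x a).1 ha).trans h)⟩
    refine (hι.isLUB_below x.2).2 ?_
    rintro _ ⟨a, ha, rfl⟩
    exact (key y a).1 (((key x a).2 ha).trans h)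
  have hsup : ∀ (x : {x : U // 0 ≤ x}) {B : Set X}, IsLUB (ι '' B) (x : U) →
      IsLUB (j '' B) (Φ x) := fun x _ hB => isLUB_map_image_of_isLUB hι hj (key x) hB
  refine ⟨Φ, fun a ha => ?_, hle, fun x y => ?_, fun x y => ?_, fun x y => ?_, fun r x h => ?_,
    ?_, fun x => ?_⟩
  · exact le_antisymm
      (hj.le_of_forall_map_le fun b hb => (hj.map_le_iff _ _).2 (hι.map_le_iff.1 ((key _ b).1 hb)))
      ((key _ a).2 le_rfl)
  -- The union of the two sets below `x` and `y` has supremum `x ⊔ y` in `U` and `Φ x ⊔ Φ y` in `C`.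
  · have hU : IsLUB (ι '' ({a | ι a ≤ x} ∪ {a | ι a ≤ y})) ((x ⊔ y : {x : U // 0 ≤ x}) : U) := by
      rw [Set.image_union]
      exact (hι.isLUB_below x.2).union (hι.isLUB_below y.2)
    have hC := (hΦ x).union (hΦ y)
    rw [← Set.image_union] at hC
    exact (hsup _ hU).unique hC
  · refine le_antisymm (le_inf ((hle _ _).2 inf_le_left) ((hle _ _).2 inf_le_right))
      (hj.le_of_forall_map_le fun a ha => (key _ a).2 ?_)
    exact le_inf ((key x a).1 (ha.trans inf_le_left)) ((key y a).1 (ha.trans inf_le_right))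
  · refine le_antisymm ?_ (hj.le_of_forall_map_le fun c hc => (key _ c).2 ?_)
    · open scoped Pointwise in
      have hU : IsLUB (ι '' ({a | ι a ≤ x} + {a | ι a ≤ y})) ((x + y : {x : U // 0 ≤ x}) : U) := by
        rw [Set.image_add]
        exact (hι.isLUB_below x.2).add (hι.isLUB_below y.2)
      refine (hsup _ hU).2 ?_
      rintro _ ⟨_, ⟨a, ha, b, hb, rfl⟩, rfl⟩
      exact (hj.map_add a b).trans_le (add_le_add ((key x a).2 ha) ((key y b).2 hb))
    -- Splitting `c` below `Φ x + Φ y` needs a non-negative summand.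
    · have h0 : 0 ≤ Φ x := hj.map_zero ▸ (key x 0).2 (by simpa using x.2)
      obtain ⟨p, q, rfl, hp, hq⟩ := hj.exists_add_of_map_le_add h0 hc
      exact (map_add ι p q).trans_le (add_le_add ((key x p).1 hp) ((key y q).1 hq))
  · rcases eq_or_ne r 0 with rfl | hr
    · rw [zero_smul, ← hj.map_zero]
      refine le_antisymm (hj.le_of_forall_map_le fun b hb => (hj.map_le_iff _ _).2 ?_)
        ((key _ 0).2 (by simp))
      have h1 : ι b ≤ ((0 : ℝ≥0) : ℝ) • (x : U) := (key _ b).1 hb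
      rw [NNReal.coe_zero, zero_smul, ← map_zero ι] at h1
      exact hι.map_le_iff.1 h1
    -- For `r ≠ 0`, scaling by `r⁻¹` reduces both inequalities to the elements of `X` below `x`.
    · have hinv : ∀ a : X, j a = r • j (((r⁻¹ : ℝ≥0) : ℝ) • a) := fun a => by
        rw [hj.map_smul, smul_inv_smul₀ hr]
      refine le_antisymm (hj.le_of_forall_map_le fun a ha => ?_)
        (hj.le_of_forall_map_le fun a ha => (key _ a).2 ?_)
      · rw [hinv]
        refine smul_le_smul_of_nonneg_left ((key x _).2 ?_) zero_le
        have h1 := smul_le_smul_of_nonneg_left ((key _ a).1 ha) (r⁻¹).2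
        rw [map_smul]
        simpa [smul_smul, hr] using h1
      · have h1 := smul_le_smul_of_nonneg_left ha (zero_le (a := r⁻¹))
        rw [inv_smul_smul₀ hr, ← hj.map_smul, key, map_smul] at h1
        have h2 := smul_le_smul_of_nonneg_left h1 r.2
        simpa [smul_smul, hr] using h2
  · intro x I _ _ _ a _ ha
    rw [Set.range_comp' ι a] at ha
    rw [Set.range_comp' j a]
    exact hsup x ha
  · refine ⟨{a | ι a ≤ x}, ⟨0, by simpa using x.2⟩, fun a ha b hb => ?_, hι.isLUB_below x.2⟩
    exact ⟨a ⊔ b, (hι.map_sup a b).trans_le (sup_le ha hb), le_sup_left, le_sup_right⟩
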